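/- All posets are finite; $x\to y$ means that $y$ covers $x$. For $b,n\ge 0$ let $\Delta_{b,n}$ be the poset formed by two incomparable elements, a chain of $b$ elements below both of them and a chain of $n$ elements (the upper chain) above both of them. **d-complete posets.** For $k\ge 3$ an interval is a $d_k$-interval if it is isomorphic to $\Delta_{k-2,k-2}$. A $d_3^-$-interval $[w;x,y]$ consists of distinct elements $x,y$ which both cover $w$; it is completed if there is $z\ge x,y$ such that $[w,z]$ is a $d_3$-interval; $[w;x,y]$ and $[w';x,y]$ overlap if $w\ne w'$. For $k\ge 4$ a $d_k^-$-interval is an interval $[w,y]\cong\Delta_{k-2,k-3}$; it is completed if there is $z\ge y$ such that $[w,z]$ is a $d_k$-interval; two $d_k^-$-intervals $[w,y],[w',y]$ overlap if $w\ne w'$ are both covered by some $x$ such that $[x,y]$ is a $d_{k-1}$-interval. A poset is $d$-complete if for all $k\ge 3$: every $d_k^-$-interval is completed; the top of a $d_k$-interval covers only elements of that interval; no two $d_k^-$-intervals overlap. A poset is connected if its diagram (the graph of its covering relations) is connected. **Irreducible components.** A connected $d$-complete poset $Q$ has a greatest element $t$. Its top tree $T$ consists of all $x$ such that $[x,t]$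 is a chain. An element is acyclic if it lies in $T$ and is not in the upper chain of any $d_k$-interval, $k\ge 3$. An edge $x\to y$ is a slant edge if $x,y\in T$ and $y$ is acyclic. The irreducible components appearing in $Q$ are the connected components, with at least two elements, of the diagram of $Q$ after removal of all slant edges; each is a poset under the order inherited from $Q$. **Sliding.** A numbering of a subset $D$ of a poset $P$ is an order preserving bijection from $D$ to a chain of $|D|$ labels. A bubble located at an element moves by being interchanged with the largest of the labels at the elements covered by its location; it is slid out by repeating this until it covers no label. Its path is the set of elements which it occupies meanwhile, including the first. The other bubbles do not move. **Crucial challenges.** Incomparable $x,y\in P$ form a crucial pair if every element covering one of them covers the other and some $w$ satisfies $w<x$, $w<y$. Put $\langle x,y\rangle=\{z: z\ge x\text{ or }z\ge y\}$ and $I_{xy}=P-\langle x,y\rangle$. A crucial challenge $((x,y),\rho)$ is a crucial pair with a numbering $\rho$ of $I_{xy}$. An $xy$-test numbering $\gamma$ of an ideal $J\ni x,y$ of $\langle x,y\rangle$ places bubbles $G_A$ at $x$, $G_B$ at $y$, and $G_1,\dots,G_n$, $n=|J|-2$, bijectively at the other elements of $J$, in such a way that if $G_i$ is at an element below that of $G_j$,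 then $i<j$. **Simultaneous solutions.** Given a crucial challenge and such a $\gamma$, put $A_1=G_A$ and $B_1=G_B$, with labels given by $\rho$, and proceed in rounds $i=1,2,\dots$. In round $i$ consider the paths of the test bubbles $A_i$ and $B_i$, each slid out first from the current snapshot. If they are disjoint, stop: $\gamma$ is an $(i-1)$-simultaneous solution. Otherwise let $w_i$ be their earliest common element, $\sigma_i$ the label at $w_i$, and move $A_i$ and $B_i$ along their paths to the elements $x_i,y_i$ at which they are one move short of $w_i$. The collision can be repaired if $i\le n$, some $z_i$ covers both $x_i$ and $y_i$, the repair bubble $G_i$ now slides to $z_i$, and $\sigma_i$ exceeds the labels at all elements other than $x_i,y_i$ covered by $z_i$. If it cannot be repaired the procedure fails. If it can, slide $G_i$ to $z_i$; then replace $G_i$ by $\sigma_i$ at $z_i$, put test bubbles $A_{i+1}$ at $x_i$ and $B_{i+1}$ at $y_i$ in place of $A_i$ and $B_i$, put a leader bubble $L_i$ at $w_i$ in place of $\sigma_i$, slide $L_i$ out, and go on to round $i+1$. An $m$-simultaneous solution is strong if for $1\le i\le m$ neither $G_i$ (until it has arrived at $z_i$, inclusive) nor $L_i$ occupies an acyclic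 element of $P$. The poset $P$ is simultaneous (respectively, strongly simultaneous, for $P$ an irreducible component) if every crucial challenge for $P$ has an $m$-simultaneous (respectively, strong $m$-simultaneous) solution for some $m\ge 0$. **Proposition 8.3.** Let $Q$ be a connected $d$-complete poset. If every irreducible component appearing in $Q$ is strongly simultaneous, then $Q$ is simultaneous. -/

import Mathlib

namespace DCompletePoset

/-! ### d-complete posets -/

/-- The poset `Δ_{b,n}`: a chain of `b` elements, above it two incomparable elements, and
above these a chain of `n` elements. -/
abbrev Delta (b n : ℕ) : Type := Fin b ⊕ₗ ((Unit ⊕ Unit) ⊕ₗ Fin n)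

/-- The element number `i` (counted upward from `0`) of the upper chain of `Δ_{b,n}`. -/
def Delta.upper {b n : ℕ} (i : Fin n) : Delta b n := toLex (Sum.inr (toLex (Sum.inr i)))

section Order

variable {P : Type*} [PartialOrder P]

/-- `[w, z]` is a `d_k`-interval (used for `3 ≤ k`). -/
def IsDInterval (k : ℕ) (w z : P) : Prop :=
  Nonempty (Set.Icc w z ≃o Delta (k - 2) (k - 2))

/-- `[w, y]` is a `d_k⁻`-interval (used for `4 ≤ k`). -/
def IsDMinusInterval (k : ℕ) (w y : P) : Prop :=
  Nonempty (Set.Icc w y ≃o Delta (k - 2) (k - 3))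

/-- `[w; x, y]` is a `d_3⁻`-interval: two distinct elements `x` and `y` both cover `w`. -/
def IsDThreeMinus (w x y : P) : Prop := x ≠ y ∧ w ⋖ x ∧ w ⋖ y

/-- `u` belongs to the upper chain of the `d_k`-interval `[w, z]`, that is, to the chain of its
`k - 2` elements which lie above its two incomparable elements. -/
def InUpperChain (k : ℕ) (w z u : P) : Prop :=
  ∃ (h : u ∈ Set.Icc w z) (e : Set.Icc w z ≃o Delta (k - 2) (k - 2)) (i : Fin (k - 2)),
    e ⟨u, h⟩ = Delta.upper i

end Order

/-- `d`-complete posets. Completing a `d_k⁻`-interval means adding an element `z` on top of it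
so that a `d_k`-interval results; for `k = 3` the `d_k⁻`-intervals have a shape of their own. -/
structure DComplete (P : Type*) [PartialOrder P] : Prop where
  /-- Every `d_3⁻`-interval is completed. -/
  complete_three : ∀ w x y : P, IsDThreeMinus w x y → ∃ z, x ≤ z ∧ y ≤ z ∧ IsDInterval 3 w z
  /-- Every `d_k⁻`-interval is completed, `4 ≤ k`. -/
  complete : ∀ k, 4 ≤ k → ∀ w y : P, IsDMinusInterval k w y → ∃ z, y ≤ z ∧ IsDInterval k w z
  /-- The top of a `d_k`-interval covers only elements of that interval. -/
  top_covers : ∀ k, 3 ≤ k → ∀ w z : P, IsDInterval k w z → ∀ u, u ⋖ z → u ∈ Set.Icc w z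
  /-- There are no overlapping `d_3⁻`-intervals. -/
  no_overlap_three : ∀ w w' x y : P, IsDThreeMinus w x y → IsDThreeMinus w' x y → w = w'
  /-- There are no overlapping `d_k⁻`-intervals, `4 ≤ k`. -/
  no_overlap : ∀ k, 4 ≤ k → ∀ w w' x y : P, IsDInterval (k - 1) x y → w ⋖ x → w' ⋖ x →
    IsDMinusInterval k w y → IsDMinusInterval k w' y → w = w'

section Slant

variable (P : Type*) [PartialOrder P]

/-- The top tree: all `x` such that the elements weakly above `x` form a chain. If `P` has a
greatest element `t` these are the elements of `[x, t]`, see `mem_topTree_iff`. -/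
def topTree : Set P := {x | IsChain (· ≤ ·) (Set.Ici x)}

theorem mem_topTree_iff {t : P} (ht : IsTop t) (x : P) :
    x ∈ topTree P ↔ IsChain (· ≤ ·) (Set.Icc x t) := by
  have h : Set.Icc x t = Set.Ici x := Set.ext fun u => ⟨fun h => h.1, fun h => ⟨h, ht u⟩⟩
  rw [h]; rfl

/-- The acyclic elements: the elements of the top tree which are not in the upper chain of any
`d_k`-interval, `3 ≤ k`. -/
def acyclic : Set P :=
  {y | y ∈ topTree P ∧ ∀ k, 3 ≤ k → ∀ w z : P, ¬ InUpperChain k w z y}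

variable {P} in
/-- The edge `x → y` of the diagram is a slant edge. -/
def IsSlantEdge (x y : P) : Prop :=
  x ⋖ y ∧ x ∈ topTree P ∧ y ∈ topTree P ∧ y ∈ acyclic P

/-- The (undirected) diagram of `P` after the removal of all slant edges. -/
def slantRemoved : SimpleGraph P where
  Adj a b := (a ⋖ b ∧ ¬ IsSlantEdge a b) ∨ (b ⋖ a ∧ ¬ IsSlantEdge b a)
  symm := ⟨fun _ _ h => h.symm⟩
  loopless := ⟨fun a h => by
    rcases h with h | h <;> exact lt_irrefl a h.1.lt⟩

variable {P} in
/-- `C` is (the set of elements of) an irreducible component appearing in `P`: a connected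
component, with at least two elements, of the diagram without its slant edges. As a poset `C`
carries the order inherited from `P`. -/
def IsIrreducibleComponent (C : Set P) : Prop :=
  (∃ c : (slantRemoved P).ConnectedComponent, C = c.supp) ∧ C.Nontrivial

end Slant

/-! ### Sliding bubbles -/

/-- A numbering of `D`: an order preserving bijection to the chain of its labels. -/
structure Numbering {P : Type*} [PartialOrder P] (D : Set P) where
  toEquiv : D ≃ Fin (Nat.card D)
  monotone : Monotone toEquiv

/-- The quasi-ordered set `{G_A, G_B, G_1 → ⋯ → G_n}`; `G i` stands for `G_{i+1}`. -/
inductive TestBubble (n : ℕ) : Type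
  | A : TestBubble n
  | B : TestBubble n
  | G (i : Fin n) : TestBubble n

/-- `G_A` and `G_B` are each below everything, and the `G_i` are ordered by their subscripts. -/
def TestBubble.le {n : ℕ} : TestBubble n → TestBubble n → Prop
  | .A, _ => True
  | .B, _ => True
  | .G _, .A => False
  | .G _, .B => False
  | .G i, .G j => i ≤ j

/-- A test numbering of `D`. -/
structure TestNumbering {P : Type*} [PartialOrder P] (D : Set P) (n : ℕ) where
  toEquiv : D ≃ TestBubble n
  monotone : ∀ p q : D, p ≤ q → (toEquiv p).le (toEquiv q)

section Sliding

variable {P : Type*} [PartialOrder P]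

/-- The filter `⟨x, y⟩`. -/
def pairFilter (x y : P) : Set P := {z | x ≤ z ∨ y ≤ z}

/-- The ideal `I_{xy} = P - ⟨x, y⟩`. -/
def pairIdeal (x y : P) : Set P := (pairFilter x y)ᶜ

/-- `(x, y)` is a crucial pair. -/
def IsCrucialPair (x y : P) : Prop :=
  ¬ x ≤ y ∧ ¬ y ≤ x ∧ (∀ z, x ⋖ z ↔ y ⋖ z) ∧ ∃ w, w < x ∧ w < y

/-- An `xy`-test numbering `γ` of an ideal `J` of `⟨x, y⟩` which contains `x` and `y`. -/
structure PairTestNumbering (x y : P) (J : Set P) (n : ℕ) extends TestNumbering J n where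
  subset : J ⊆ pairFilter x y
  ideal : ∀ p ∈ J, ∀ q ∈ pairFilter x y, q ≤ p → q ∈ J
  map_x : ∃ h : x ∈ J, toEquiv ⟨x, h⟩ = TestBubble.A
  map_y : ∃ h : y ∈ J, toEquiv ⟨y, h⟩ = TestBubble.B

/-- The initial location `v_{i+1}` of the bubble `G_{i+1}`. -/
def PairTestNumbering.site {x y : P} {J : Set P} {n : ℕ} (γ : PairTestNumbering x y J n)
    (i : Fin n) : P := (γ.toEquiv.symm (TestBubble.G i) : P)

open Classical in
/-- The positions of the labels: `some j` at an element holding the label `R_{j+1}`, and `none`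
at the elements which do not hold a label (they hold a bubble or nothing). -/
noncomputable def Numbering.labels {D : Set P} (ρ : Numbering D) : P → Option ℕ :=
  fun p => if h : p ∈ D then some (ρ.toEquiv ⟨p, h⟩ : ℕ) else none

end Sliding

/-- The part of a bi-numbering that matters while one bubble moves: where the labels are, and
where the moving bubble is. All other bubbles are passive, at elements without a label. -/
structure Snapshot (P : Type*) where
  labels : P → Option ℕ
  bubble : P

namespace Snapshot

variable {P : Type*} [PartialOrder P]

/-- The label at `u` is the largest of the labels covered by the bubble. -/
def IsNext (s : Snapshot P) (u : P) : Prop :=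
  u ⋖ s.bubble ∧ ∃ j, s.labels u = some j ∧
    ∀ u' j', u' ⋖ s.bubble → s.labels u' = some j' → j' ≤ j

open Classical in
/-- The move operator: interchange the bubble with the largest of the labels it covers, if it
covers a label, and do nothing otherwise. -/
noncomputable def move (s : Snapshot P) : Snapshot P :=
  if h : ∃ u, s.IsNext u then
    ⟨Function.update (Function.update s.labels s.bubble (s.labels h.choose)) h.choose none,
      h.choose⟩
  else s

/-- The path of the bubble: all elements occupied by it while it is slid out. -/
def path (s : Snapshot P) : Set P := Set.range fun k : ℕ => (move^[k] s).bubble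

/-- The slideout operator: move the bubble until it does not move any more. Every actual move
goes strictly down, so that `|P|` moves suffice; see `move_slideOut`. -/
noncomputable def slideOut (s : Snapshot P) : Snapshot P := move^[Nat.card P] s

theorem move_eq_or_lt (s : Snapshot P) : move s = s ∨ (move s).bubble < s.bubble := by
  by_cases h : ∃ u, s.IsNext u
  · right
    have : (move s).bubble = h.choose := by rw [move, dif_pos h]
    rw [this]; exact h.choose_spec.1.lt
  · left; rw [move, dif_neg h]

theorem move_slideOut [Finite P] (s : Snapshot P) : move (slideOut s) = slideOut s := by
  by_contra hne
  have step : ∀ k, k ≤ Nat.card P → (move^[k + 1] s).bubble < (move^[k] s).bubble := by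
    intro k hk
    rw [Function.iterate_succ_apply']
    rcases move_eq_or_lt (move^[k] s) with h | h
    · exfalso; apply hne
      have : slideOut s = move^[k] s := by
        obtain ⟨d, hd⟩ := Nat.exists_eq_add_of_le hk
        rw [slideOut, hd, Nat.add_comm, Function.iterate_add_apply]
        exact Function.iterate_fixed h d
      rw [this, h]
    · exact h
  have anti : ∀ d k, k + d + 1 ≤ Nat.card P →
      (move^[k + d + 1] s).bubble < (move^[k] s).bubble := by
    intro d
    induction d with
    | zero => intro k hk; exact step k (by omega)
    | succ d ih =>
      intro k hk
      exact (step (k + d + 1) (by omega)).trans (ih k (by omega))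
  have inj : Function.Injective fun i : Fin (Nat.card P + 1) => (move^[(i : ℕ)] s).bubble := by
    intro i j hij
    by_contra hne'
    rcases lt_or_gt_of_ne (fun h => hne' (Fin.ext h) : (i : ℕ) ≠ j) with h | h
    · obtain ⟨d, hd⟩ := Nat.exists_eq_add_of_lt h
      have := anti d i (by omega)
      rw [← hd] at this
      exact absurd hij this.ne'
    · obtain ⟨d, hd⟩ := Nat.exists_eq_add_of_lt h
      have := anti d j (by omega)
      rw [← hd] at this
      exact absurd hij this.ne
  have := Nat.card_le_card_of_injective _ inj
  simp at this

end Snapshot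

/-! ### Simultaneous posets -/

section Simultaneous

variable {P : Type*} [PartialOrder P]

open Snapshot

/-- With the labels `ℓ`, test bubbles `A` at `a` and `B` at `b` collide at `w`, the earliest
common element of their paths. They are one move short of `w` at `x` after `i` moves of `A`, and
at `y` after `j` moves of `B`, and `σ` is the label at `w`. -/
structure IsCollision (ℓ : P → Option ℕ) (a b w x y : P) (i j σ : ℕ) : Prop where
  isGreatest : IsGreatest (path ⟨ℓ, a⟩ ∩ path ⟨ℓ, b⟩) w
  label : ℓ w = some σ
  x_ne : x ≠ w
  x_eq : (move^[i] ⟨ℓ, a⟩).bubble = x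
  x_next : (move^[i + 1] ⟨ℓ, a⟩).bubble = w
  y_ne : y ≠ w
  y_eq : (move^[j] ⟨ℓ, b⟩).bubble = y
  y_next : (move^[j + 1] ⟨ℓ, b⟩).bubble = w

/-- The labels after `A` has made `i` moves from `a` and `B` has made `j` moves from `b`. -/
noncomputable def approach (ℓ : P → Option ℕ) (a b : P) (i j : ℕ) : P → Option ℕ :=
  (move^[j] ⟨(move^[i] ⟨ℓ, a⟩).labels, b⟩).labels

open Classical in
/-- The snapshot just after a repair, with the leader bubble at `w`: the label `σ` has been put
in the place `z` of the repair bubble, and the leader bubble in the place `w` of `σ`. -/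
noncomputable def leaderStart (ℓ : P → Option ℕ) (w z : P) (σ : ℕ) : Snapshot P :=
  ⟨Function.update (Function.update ℓ z (some σ)) w none, w⟩

/-- One round of the procedure. With the labels `ℓ` and the test bubbles at `a` and `b`, a
collision arises. The repair bubble, initially at `v`, is capable of repairing it: once the test
bubbles are at `x` and `y`, it slides down (in `k` moves) to an element `z` which covers both, and
the label at the collision site is greater than the labels at the other elements covered by `z`.
The collision is repaired, the leader bubble is slid out, and this leaves the labels `ℓ'`, with
the next test bubbles at `x` and `y`. Neither the repair bubble on its way to `z` nor the leader
bubble occupies an element of `avoid`. -/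
def RepairRound (avoid : Set P) (ℓ : P → Option ℕ) (a b v : P) (ℓ' : P → Option ℕ) (x y : P) :
    Prop :=
  ∃ (w z : P) (i j k σ : ℕ),
    IsCollision ℓ a b w x y i j σ ∧
    x ⋖ z ∧ y ⋖ z ∧
    (move^[k] ⟨approach ℓ a b i j, v⟩).bubble = z ∧
    (∀ u τ, u ⋖ z → u ≠ x → u ≠ y → ℓ u = some τ → τ < σ) ∧
    (∀ l ≤ k, (move^[l] ⟨approach ℓ a b i j, v⟩).bubble ∉ avoid) ∧
    (∀ p ∈ path (leaderStart (move^[k] ⟨approach ℓ a b i j, v⟩).labels w z σ), p ∉ avoid) ∧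
    ℓ' = (slideOut (leaderStart (move^[k] ⟨approach ℓ a b i j, v⟩).labels w z σ)).labels

/-- Starting with the labels `ℓ` and the test bubbles at `a` and `b`, exactly `m` collisions
arise and are successively repaired by the bubbles which start at `v r`, `v (r + 1)`, and so on;
the paths of the test bubbles after that do not intersect. -/
def SolvesFrom (avoid : Set P) {n : ℕ} (v : Fin n → P) :
    (m r : ℕ) → (ℓ : P → Option ℕ) → (a b : P) → Prop
  | 0, _, ℓ, a, b => path ⟨ℓ, a⟩ ∩ path ⟨ℓ, b⟩ = ∅
  | m + 1, r, ℓ, a, b => ∃ (h : r < n) (ℓ' : P → Option ℕ) (x y : P),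
      RepairRound avoid ℓ a b (v ⟨r, h⟩) ℓ' x y ∧ SolvesFrom avoid v m (r + 1) ℓ' x y

/-- `γ` is an `m`-simultaneous solution to the crucial challenge `((x, y), ρ)`. -/
def IsSimultaneousSolution {x y : P} {J : Set P} {n : ℕ} (m : ℕ)
    (γ : PairTestNumbering x y J n) (ρ : Numbering (pairIdeal x y)) : Prop :=
  SolvesFrom ∅ γ.site m 0 ρ.labels x y

/-- `γ` is a strong `m`-simultaneous solution: in addition no repair bubble (up to its arrival at
the repair site) and no leader bubble reaches an acyclic element. -/
def IsStrongSimultaneousSolution {x y : P} {J : Set P} {n : ℕ} (m : ℕ)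
    (γ : PairTestNumbering x y J n) (ρ : Numbering (pairIdeal x y)) : Prop :=
  SolvesFrom (acyclic P) γ.site m 0 ρ.labels x y

variable (P)

/-- Every crucial challenge has an `m`-simultaneous solution for some `m`. -/
def Simultaneous : Prop :=
  ∀ x y : P, IsCrucialPair x y → ∀ ρ : Numbering (pairIdeal x y),
    ∃ (m n : ℕ) (J : Set P) (γ : PairTestNumbering x y J n), IsSimultaneousSolution m γ ρ

/-- Every crucial challenge has a strong `m`-simultaneous solution for some `m`. -/
def StronglySimultaneous : Prop :=
  ∀ x y : P, IsCrucialPair x y → ∀ ρ : Numbering (pairIdeal x y),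
    ∃ (m n : ℕ) (J : Set P) (γ : PairTestNumbering x y J n), IsStrongSimultaneousSolution m γ ρ

end Simultaneous

end DCompletePoset

namespace DCompletePoset

open Snapshot

/-! ### Slant edges and irreducible components -/

section Structure

variable {P : Type*} [PartialOrder P]

/-! A slant edge `x → y` is the only link between the elements below `x` and the rest of the poset
(`IsSlantEdge.le_or_le`): a second way up would create a `d_3`-interval with `y` on top, against `y`
being acyclic. Hence components are convex, and both members of a crucial pair lie in one component
`C`, together with a common lower bound. The challenge therefore restricts to a challenge for `C`,
with the labels renumbered. A strong solution there is replayed in the whole poset, round by round.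

The replay can only go wrong where a bubble sees labels outside `C`. An element of `C` that covers
something outside `C` is the upper end of a slant edge, hence acyclic in `C`
(`IsIrreducibleComponent.mem_of_covBy`). Repair and leader bubbles of a strong solution avoid such
elements, so they move identically in both posets. Test bubbles need not avoid them. But once a test
bubble leaves `C` the two test paths are disjoint (`IsIrreducibleComponent.path_subset`), and the
procedure stops successfully, perhaps earlier than in `C`.

The two test bubbles are moved one after the other, although their paths are read off the same
snapshot. That the first does not deflect the second before the collision needs order preserving
labels below the test bubbles; this is the `RoundInvariant`, and `RoundInvariant.next` carries it
through a repair. -/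

theorem Delta.eq_upper_of_lt_lt {p q r : Delta 1 1} (h₁ : p < q) (h₂ : q < r) :
    r = Delta.upper 0 := by
  have cases : ∀ s : Delta 1 1, s = toLex (Sum.inl 0) ∨ s = Delta.upper 0 ∨
      ∃ t : Unit ⊕ Unit, s = toLex (Sum.inr (toLex (Sum.inl t))) := by
    rintro (s | s | s)
    · exact Or.inl (by rw [Subsingleton.elim s 0]; rfl)
    · exact Or.inr (Or.inr ⟨s, rfl⟩)
    · exact Or.inr (Or.inl (by rw [Subsingleton.elim s 0]; rfl))
  rcases cases p with rfl | rfl | ⟨p, rfl⟩ <;> rcases cases q with rfl | rfl | ⟨q, rfl⟩ <;>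
    rcases cases r with rfl | rfl | ⟨r, rfl⟩ <;>
    simp_all [Delta.upper]
  · exact absurd h₂ (by rcases q with _ | _ <;> rcases r with _ | _ <;> simp)
  · exact absurd h₁ (by rcases p with _ | _ <;> rcases q with _ | _ <;> simp)

/-- The elements below the lower end of a slant edge are attached to the rest only through it. -/
theorem IsSlantEdge.le_or_le [Finite P] (hd : DComplete P) {x y : P} (h : IsSlantEdge x y)
    {u v : P} (hux : u ≤ x) (huv : u ≤ v) : v ≤ x ∨ y ≤ v := by
  induction u using WellFoundedGT.induction generalizing v with
  | ind u ih =>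
  rcases hux.eq_or_lt with rfl | hlt
  · rcases huv.eq_or_lt with rfl | hlt
    · exact Or.inl le_rfl
    · right
      rcases h.2.1.total (Set.mem_Ici.2 h.1.le) (Set.mem_Ici.2 hlt.le) with hc | hc
      · exact hc
      · exact (((h.1.eq_or_eq hlt.le hc).resolve_left hlt.ne').ge)
  · rcases huv.eq_or_lt with rfl | hlt'
    · exact Or.inl hux
    obtain ⟨u₁, hu₁, hu₁x⟩ := exists_covBy_le_of_lt hlt
    obtain ⟨v₁, hv₁, hv₁v⟩ := exists_covBy_le_of_lt hlt'
    by_cases hv₁x : v₁ ≤ x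
    · exact ih v₁ hv₁.lt hv₁x hv₁v
    exfalso
    have hne : u₁ ≠ v₁ := fun e => hv₁x (e ▸ hu₁x)
    -- The two diverging covers of `u` span a diamond with top `z`. The induction hypothesis at `u₁`
    -- puts `z` above `y`, so `u < x < y` is a three-element chain in the diamond, and `y` must be
    -- its top.
    obtain ⟨z, hz₁, hz₂, ⟨e⟩⟩ := hd.complete_three u u₁ v₁ ⟨hne, hu₁, hv₁⟩
    have hyz : y ≤ z := (ih u₁ hu₁.lt hu₁x hz₁).resolve_left fun hz => hv₁x (hz₂.trans hz)
    have hu : u ∈ Set.Icc u z := ⟨le_rfl, hu₁.le.trans hz₁⟩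
    have hx : x ∈ Set.Icc u z := ⟨hux, h.1.le.trans hyz⟩
    have hy : y ∈ Set.Icc u z := ⟨hux.trans h.1.le, hyz⟩
    refine h.2.2.2.2 3 le_rfl u z ⟨hy, e, 0, ?_⟩
    exact Delta.eq_upper_of_lt_lt (p := e ⟨u, hu⟩) (q := e ⟨x, hx⟩)
      (e.lt_iff_lt.2 hlt) (e.lt_iff_lt.2 h.1.lt)

theorem reachable_of_no_slantEdge [Finite P] {u v : P} (huv : u ≤ v)
    (h : ∀ p q, u ≤ p → q ≤ v → ¬ IsSlantEdge p q) : (slantRemoved P).Reachable u v := by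
  induction u using WellFoundedGT.induction with
  | ind u ih =>
  rcases huv.eq_or_lt with rfl | hlt
  · exact SimpleGraph.Reachable.refl _
  obtain ⟨u₁, hu₁, hu₁v⟩ := exists_covBy_le_of_lt hlt
  have hadj : (slantRemoved P).Adj u u₁ := Or.inl ⟨hu₁, h u u₁ le_rfl hu₁v⟩
  exact hadj.reachable.trans
    (ih u₁ hu₁.lt hu₁v fun p q hp hq => h p q (hu₁.le.trans hp) hq)

/-- The diagram without its slant edges does not connect the two ends of a slant edge. -/
theorem IsSlantEdge.le_iff_le_of_reachable [Finite P] (hd : DComplete P) {x y : P}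
    (h : IsSlantEdge x y) {u v : P} (hr : (slantRemoved P).Reachable u v) : u ≤ x ↔ v ≤ x := by
  have step : ∀ c d, c ⋖ d → ¬ IsSlantEdge c d → (c ≤ x ↔ d ≤ x) := by
    intro c d hcd hs
    -- An edge `c → d` from below `x` to above `y` has no room for `x` or `y` strictly inside, so it
    -- is the slant edge itself.
    refine ⟨fun hc => (h.le_or_le hd hc hcd.le).resolve_right fun hyd => ?_, hcd.le.trans⟩
    have hcx : c = x := by
      by_contra hne
      exact hcd.2 (lt_of_le_of_ne hc hne) (h.1.lt.trans_le hyd)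
    subst hcx
    have hyd' : y = d := by
      by_contra hne
      exact hcd.2 h.1.lt (lt_of_le_of_ne hyd hne)
    exact hs (hyd' ▸ h)
  obtain ⟨p⟩ := hr
  induction p with
  | nil => rfl
  | cons hadj _ ih =>
    refine Iff.trans ?_ ih
    rcases hadj with ⟨h₁, h₂⟩ | ⟨h₁, h₂⟩
    · exact step _ _ h₁ h₂
    · exact (step _ _ h₁ h₂).symm

variable {C : Set P}

theorem IsIrreducibleComponent.mem_of_reachable (hC : IsIrreducibleComponent C) {u v : P}
    (hu : u ∈ C) (h : (slantRemoved P).Reachable u v) : v ∈ C := by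
  obtain ⟨⟨c, rfl⟩, -⟩ := hC
  rw [SimpleGraph.ConnectedComponent.mem_supp_iff] at hu ⊢
  rw [← hu]
  exact (SimpleGraph.ConnectedComponent.sound h).symm

theorem IsIrreducibleComponent.reachable (hC : IsIrreducibleComponent C) {u v : P}
    (hu : u ∈ C) (hv : v ∈ C) : (slantRemoved P).Reachable u v := by
  obtain ⟨⟨c, rfl⟩, -⟩ := hC
  rw [SimpleGraph.ConnectedComponent.mem_supp_iff] at hu hv
  exact SimpleGraph.ConnectedComponent.exact (hu.trans hv.symm)

theorem IsIrreducibleComponent.isSlantEdge (hC : IsIrreducibleComponent C) {u v : P}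
    (huv : u ⋖ v) (hv : v ∈ C) (hu : u ∉ C) : IsSlantEdge u v := by
  by_contra hs
  have hadj : (slantRemoved P).Adj v u := Or.inr ⟨huv, hs⟩
  exact hu (hC.mem_of_reachable hv hadj.reachable)

/-- A slant edge `p → p'` within `[u, v]` would separate `u` from `v`: since `u ≤ p`, reachability
forces `v ≤ p`, although `p < p' ≤ v`. -/
theorem IsIrreducibleComponent.ordConnected [Finite P] (hd : DComplete P)
    (hC : IsIrreducibleComponent C) : C.OrdConnected := by
  refine ⟨fun u hu v hv q hq => hC.mem_of_reachable hu (reachable_of_no_slantEdge hq.1 ?_)⟩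
  intro p p' hp hp' hs
  have hvp := (hs.le_iff_le_of_reachable hd (hC.reachable hu hv)).1 hp
  exact (hs.1.lt.trans_le (hp'.trans (hq.2.trans hvp))).false

theorem coe_covBy_coe (hC : C.OrdConnected) {u v : C} : (u : P) ⋖ v ↔ u ⋖ v :=
  Set.OrdConnected.apply_covBy_apply_iff (OrderEmbedding.subtype (· ∈ C)) (by simpa using hC)

/-- The interval `[w, z]` of an order connected subset is the interval `[w, z]` of the poset. -/
def iccOrderIso (hC : C.OrdConnected) (w z : C) : Set.Icc w z ≃o Set.Icc (w : P) (z : P) where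
  toFun u := ⟨u.1, u.2.1, u.2.2⟩
  invFun u := ⟨⟨u.1, hC.out w.2 z.2 u.2⟩, u.2.1, u.2.2⟩
  left_inv _ := rfl
  right_inv _ := rfl
  map_rel_iff' := Iff.rfl

/-- An element of a component which is not acyclic there covers only elements of it. -/
theorem IsIrreducibleComponent.mem_of_covBy [Finite P] (hd : DComplete P)
    (hC : IsIrreducibleComponent C) {c : C} (hc : c ∉ acyclic C) {u : P} (hu : u ⋖ c) :
    u ∈ C := by
  by_contra huC
  have hs := hC.isSlantEdge hu c.2 huC
  -- Acyclicity passes from the poset to `C`: chains restrict, and by convexity every `d_k`-interval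
  -- of `C` is one of the whole poset.
  refine hc ⟨fun p hp q hq hne => ?_, ?_⟩
  · exact hs.2.2.1 (Set.mem_Ici.2 (Subtype.coe_le_coe.2 hp))
      (Set.mem_Ici.2 (Subtype.coe_le_coe.2 hq)) (fun e => hne (Subtype.ext e))
  · rintro k hk w z ⟨h, e, i, he⟩
    exact hs.2.2.2.2 k hk w z
      ⟨⟨h.1, h.2⟩, (iccOrderIso (hC.ordConnected hd) w z).symm.trans e, i, he⟩

/-- Choose a maximal common lower bound `w`. A slant edge `p → q` between `w` and `x` would have
either `y ≤ p`, making the pair comparable, or `q ≤ y`, making `q` a larger common lower bound. So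
no slant edge lies between `w` and `x`, and likewise for `y`. -/
theorem IsCrucialPair.exists_component [Finite P] (hd : DComplete P) {x y : P}
    (h : IsCrucialPair x y) :
    ∃ C : Set P, IsIrreducibleComponent C ∧ x ∈ C ∧ y ∈ C ∧ ∃ w ∈ C, w < x ∧ w < y := by
  obtain ⟨hxy, hyx, -, hw⟩ := h
  obtain ⟨w, ⟨hwx, hwy⟩, hmax⟩ :=
    (Set.toFinite {w | w < x ∧ w < y}).exists_maximal hw
  have reach : ∀ a b : P, w < a → w < b → ¬ b ≤ a → (∀ q, q < a → q < b → w ≤ q → q ≤ w) →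
      ¬ a ≤ b → (slantRemoved P).Reachable w a := by
    intro a b ha hb hba hm hab
    refine reachable_of_no_slantEdge ha.le fun p q hp hq hs => ?_
    rcases hs.le_or_le hd hp hb.le with hbp | hqb
    · exact hba (hbp.trans (hs.1.le.trans hq))
    · have hqa : q < a := lt_of_le_of_ne hq fun e => hab (e ▸ hqb)
      have hqb' : q < b := lt_of_le_of_ne hqb fun e => hba (e ▸ hq)
      exact ((hp.trans_lt hs.1.lt).not_ge
        (hm q hqa hqb' (hp.trans hs.1.le)))
  have hx := reach x y hwx hwy hyx (fun q h₁ h₂ h₃ => hmax ⟨h₁, h₂⟩ h₃) hxy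
  have hy := reach y x hwy hwx hxy (fun q h₁ h₂ h₃ => hmax ⟨h₂, h₁⟩ h₃) hyx
  have hmem : ∀ v, (slantRemoved P).Reachable w v →
      v ∈ ((slantRemoved P).connectedComponentMk w).supp := fun v hv =>
    SimpleGraph.ConnectedComponent.sound hv.symm
  have hww := hmem w (SimpleGraph.Reachable.refl _)
  exact ⟨_, ⟨⟨_, rfl⟩, ⟨w, hww, x, hmem x hx, hwx.ne⟩⟩, hmem x hx, hmem y hy, w, hww, hwx, hwy⟩

end Structure

/-! ### Paths of bubbles and the labels they displace -/

section Moves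

variable {P : Type*} [PartialOrder P]

/-- No label occurs twice. -/
def InjectiveLabels (ℓ : P → Option ℕ) : Prop :=
  ∀ u v j, ℓ u = some j → ℓ v = some j → u = v

namespace Snapshot

variable {s : Snapshot P}

theorem IsNext.unique (hs : InjectiveLabels s.labels) {u v : P} (hu : s.IsNext u)
    (hv : s.IsNext v) : u = v := by
  obtain ⟨hu, i, hi, hui⟩ := hu
  obtain ⟨hv, j, hj, hvj⟩ := hv
  have hij := le_antisymm (hvj u i hu hi) (hui v j hv hj)
  subst hij
  exact hs u v _ hi hj

theorem exists_isNext [Finite P] {u : P} {j : ℕ} (hu : u ⋖ s.bubble) (hj : s.labels u = some j) :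
    ∃ v, s.IsNext v := by
  obtain ⟨v, ⟨hv, i, hi⟩, hmax⟩ := Set.exists_max_image
    {v | v ⋖ s.bubble ∧ ∃ i, s.labels v = some i}
    (fun v => (s.labels v).getD 0) (Set.toFinite _) ⟨u, hu, j, hj⟩
  refine ⟨v, hv, i, hi, fun v' i' hv' hi' => ?_⟩
  simpa [hi, hi'] using hmax v' ⟨hv', i', hi'⟩

open Classical in
theorem move_of_isNext (hs : InjectiveLabels s.labels) {u : P} (hu : s.IsNext u) :
    move s = ⟨Function.update (Function.update s.labels s.bubble (s.labels u)) u none, u⟩ := by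
  have h : ∃ u, s.IsNext u := ⟨u, hu⟩
  have e : h.choose = u := h.choose_spec.unique hs hu
  rw [move, dif_pos h, e]

theorem move_of_not_isNext (h : ∀ u, ¬ s.IsNext u) : move s = s := by
  rw [move, dif_neg (by simpa using h)]

theorem bubble_move_of_isNext (hs : InjectiveLabels s.labels) {u : P} (hu : s.IsNext u) :
    (move s).bubble = u := by
  rw [move_of_isNext hs hu]

open Classical in
theorem labels_move_of_isNext (hs : InjectiveLabels s.labels) {u : P} (hu : s.IsNext u) (p : P) :
    (move s).labels p =
      if p = u then none else if p = s.bubble then s.labels u else s.labels p := by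
  rw [move_of_isNext hs hu]
  simp [Function.update_apply]

theorem injectiveLabels_move (hs : InjectiveLabels s.labels) :
    InjectiveLabels (move s).labels := by
  by_cases h : ∃ u, s.IsNext u
  · obtain ⟨u, hu⟩ := h
    intro p q j hp hq
    rw [labels_move_of_isNext hs hu] at hp hq
    have := hs p q j
    have := hs p u j
    have := hs u q j
    split_ifs at hp hq <;> simp_all
  · rwa [move_of_not_isNext (by simpa using h)]

theorem injectiveLabels_iterate (hs : InjectiveLabels s.labels) (k : ℕ) :
    InjectiveLabels (move^[k] s).labels := by
  induction k with
  | zero => exact hs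
  | succ k ih => rw [Function.iterate_succ_apply']; exact injectiveLabels_move ih

theorem move_le (s : Snapshot P) : (move s).bubble ≤ s.bubble := by
  rcases move_eq_or_lt s with h | h
  · rw [h]
  · exact h.le

theorem iterate_antitone (s : Snapshot P) : Antitone fun k => (move^[k] s).bubble :=
  antitone_nat_of_succ_le fun k => by
    rw [Function.iterate_succ_apply']; exact move_le _

theorem iterate_le (s : Snapshot P) (k : ℕ) : (move^[k] s).bubble ≤ s.bubble :=
  iterate_antitone s (Nat.zero_le k)

theorem mem_path (s : Snapshot P) (k : ℕ) : (move^[k] s).bubble ∈ path s := ⟨k, rfl⟩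

theorem le_of_mem_path {p : P} (hp : p ∈ path s) : p ≤ s.bubble := by
  obtain ⟨k, rfl⟩ := hp
  exact iterate_le s k

/-- A path continues as long as the bubble has not arrived at its final location. -/
theorem isNext_of_ne (hs : InjectiveLabels s.labels) {k l : ℕ} (hkl : k < l)
    (h : (move^[l] s).bubble ≠ (move^[k] s).bubble) :
    (move^[k] s).IsNext (move^[k + 1] s).bubble := by
  by_cases hn : ∃ u, (move^[k] s).IsNext u
  · obtain ⟨u, hu⟩ := hn
    rwa [Function.iterate_succ_apply',
      bubble_move_of_isNext (injectiveLabels_iterate hs k) hu]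
  · refine absurd ?_ h
    have hfix : move (move^[k] s) = move^[k] s := move_of_not_isNext (by simpa using hn)
    obtain ⟨d, rfl⟩ := Nat.exists_eq_add_of_lt hkl
    rw [show k + d + 1 = (d + 1) + k by omega, Function.iterate_add_apply,
      Function.iterate_fixed hfix]

theorem labels_iterate_of_notMem_path (hs : InjectiveLabels s.labels) (k : ℕ) {p : P}
    (hp : p ∉ path s) : (move^[k] s).labels p = s.labels p := by
  induction k with
  | zero => rfl
  | succ k ih =>
    have hk : InjectiveLabels (move^[k] s).labels := injectiveLabels_iterate hs k
    by_cases h : ∃ u, (move^[k] s).IsNext u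
    · obtain ⟨u, hu⟩ := h
      have h₁ : p ≠ (move^[k] s).bubble := fun e => hp (e ▸ mem_path s k)
      have h₂ : p ≠ u := by
        rintro rfl
        apply hp
        rw [← bubble_move_of_isNext hk hu, ← Function.iterate_succ_apply' move]
        exact mem_path s _
      rw [Function.iterate_succ_apply', labels_move_of_isNext hk hu, if_neg h₂, if_neg h₁, ih]
    · rw [Function.iterate_succ_apply', move_of_not_isNext (by simpa using h), ih]

/-- Moves go downward and change labels only at locations of the bubble, all of which lie weakly
above its present one. -/
theorem labels_iterate_of_not_le (hs : InjectiveLabels s.labels) {k : ℕ} {p : P}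
    (hp : ¬ (move^[k] s).bubble ≤ p) : (move^[k] s).labels p = s.labels p := by
  induction k with
  | zero => rfl
  | succ k ih =>
    have hk : InjectiveLabels (move^[k] s).labels := injectiveLabels_iterate hs k
    rw [Function.iterate_succ_apply'] at hp ⊢
    rw [← ih fun h => hp ((move_le _).trans h)]
    by_cases h : ∃ u, (move^[k] s).IsNext u
    · obtain ⟨u, hu⟩ := h
      rw [bubble_move_of_isNext hk hu] at hp
      rw [labels_move_of_isNext hk hu, if_neg, if_neg]
      · rintro rfl; exact hp hu.1.le
      · rintro rfl; exact hp le_rfl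
    · rw [move_of_not_isNext (by simpa using h)]

/-- A label covered by the bubble slides only upward, so that no element gets a larger label. -/
theorem labels_iterate_le (hs : InjectiveLabels s.labels)
    (hlt : ∀ u v i j, u < v → v < s.bubble → s.labels u = some i → s.labels v = some j → i < j)
    (k : ℕ) {p : P} {j : ℕ} (hpb : p ≠ s.bubble) (hp : (move^[k] s).labels p = some j) :
    ∃ j', j ≤ j' ∧ s.labels p = some j' := by
  -- Wherever the bubble has moved to, a label stood originally; it is the one to compare with the
  -- label that replaces it when the bubble moves on.
  have hlab : ∀ k, (move^[k] s).bubble = s.bubble ∨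
      (move^[k] s).bubble < s.bubble ∧ ∃ i, s.labels (move^[k] s).bubble = some i := by
    intro k
    induction k with
    | zero => exact Or.inl rfl
    | succ k ih =>
      have hk : InjectiveLabels (move^[k] s).labels := injectiveLabels_iterate hs k
      rw [Function.iterate_succ_apply']
      by_cases h : ∃ u, (move^[k] s).IsNext u
      · obtain ⟨u, hu⟩ := h
        rw [bubble_move_of_isNext hk hu]
        obtain ⟨i, hi, -⟩ := hu.2
        rw [labels_iterate_of_not_le hs hu.1.lt.not_ge] at hi
        exact Or.inr ⟨hu.1.lt.trans_le (iterate_le s k), i, hi⟩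
      · rwa [move_of_not_isNext (by simpa using h)]
  induction k generalizing j with
  | zero => exact ⟨j, le_rfl, hp⟩
  | succ k ih =>
    have hk : InjectiveLabels (move^[k] s).labels := injectiveLabels_iterate hs k
    rw [Function.iterate_succ_apply'] at hp
    by_cases h : ∃ u, (move^[k] s).IsNext u
    · obtain ⟨u, hu⟩ := h
      rw [labels_move_of_isNext hk hu] at hp
      split_ifs at hp with h₁ h₂
      · rw [labels_iterate_of_not_le hs hu.1.lt.not_ge] at hp
        rcases hlab k with he | ⟨hl, i, hi⟩
        · exact absurd (h₂.trans he) hpb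
        · subst h₂
          exact ⟨i, (hlt _ _ _ _ hu.1.lt hl hp hi).le, hi⟩
      · exact ih hp
    · rw [move_of_not_isNext (by simpa using h)] at hp
      exact ih hp

end Snapshot

/-! ### Invariants of a round -/

/-- What is needed of the labels at the beginning of a round: below the test bubbles they are
order preserving, and the elements without a label form an ideal. -/
structure RoundInvariant (ℓ : P → Option ℕ) (a b : P) : Prop where
  injective : InjectiveLabels ℓ
  not_le : ¬ a ≤ b
  not_ge : ¬ b ≤ a
  lt : ∀ u v i j, u < v → (v < a ∨ v < b) → ℓ u = some i → ℓ v = some j → i < j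
  hole : ∀ u v, u < v → (v < a ∨ v < b) → ℓ v = none → ℓ u = none

/-- The path of the second test bubble is not affected by the moves which the first one makes
before the collision. -/
theorem RoundInvariant.bubble_iterate {ℓ : P → Option ℕ} {a b w x y : P} {i j σ : ℕ}
    (h : RoundInvariant ℓ a b) (hc : IsCollision ℓ a b w x y i j σ) {l : ℕ} (hl : l ≤ j) :
    (move^[l] ⟨(move^[i] ⟨ℓ, a⟩).labels, b⟩).bubble = (move^[l] ⟨ℓ, b⟩).bubble := by
  induction l with
  | zero => rfl
  | succ l ih =>
    have ih := ih (by omega)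
    have hA : InjectiveLabels (move^[i] (⟨ℓ, a⟩ : Snapshot P)).labels :=
      injectiveLabels_iterate (s := ⟨ℓ, a⟩) h.injective i
    have hB : InjectiveLabels
        (move^[l] (⟨(move^[i] ⟨ℓ, a⟩).labels, b⟩ : Snapshot P)).labels :=
      injectiveLabels_iterate (s := ⟨(move^[i] ⟨ℓ, a⟩).labels, b⟩) hA l
    have hwy : w < y := lt_of_le_of_ne
      (by rw [← hc.y_eq, ← hc.y_next]; exact iterate_antitone _ (Nat.le_succ j)) hc.y_ne.symm
    have hyl : y ≤ (move^[l + 1] (⟨ℓ, b⟩ : Snapshot P)).bubble := by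
      rw [← hc.y_eq]; exact iterate_antitone _ hl
    have hnext : (move^[l] (⟨ℓ, b⟩ : Snapshot P)).IsNext
        (move^[l + 1] (⟨ℓ, b⟩ : Snapshot P)).bubble := by
      refine isNext_of_ne (s := ⟨ℓ, b⟩) h.injective (show l < j + 1 by omega) ?_
      rw [hc.y_next]
      refine (hwy.trans_le (hyl.trans ?_)).ne
      exact iterate_antitone _ (Nat.le_succ l)
    have key : (move^[l] (⟨(move^[i] ⟨ℓ, a⟩).labels, b⟩ : Snapshot P)).IsNext
        (move^[l + 1] (⟨ℓ, b⟩ : Snapshot P)).bubble := by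
      obtain ⟨hcov, τ, hτ, hmax⟩ := hnext
      rw [labels_iterate_of_not_le (s := ⟨ℓ, b⟩) h.injective hcov.lt.not_ge] at hτ
      refine ⟨ih ▸ hcov, τ, ?_, ?_⟩
      · rw [labels_iterate_of_not_le (s := ⟨(move^[i] ⟨ℓ, a⟩).labels, b⟩) hA
          (by rw [ih]; exact hcov.lt.not_ge)]
        rw [← hτ]
        -- The next location of `B` is still above `w`, the greatest common element, so `A` never
        -- visits it and its label stands. The competing labels can only have decreased, so it
        -- remains the largest.
        refine labels_iterate_of_notMem_path (s := ⟨ℓ, a⟩) h.injective i fun hmem => ?_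
        exact (hwy.trans_le hyl).not_ge (hc.isGreatest.2 ⟨hmem, mem_path _ _⟩)
      · intro u τ' hu hτ'
        rw [labels_iterate_of_not_le (s := ⟨(move^[i] ⟨ℓ, a⟩).labels, b⟩) hA
          hu.lt.not_ge] at hτ'
        rw [ih] at hu
        have hub : u < b := hu.lt.trans_le (iterate_le (⟨ℓ, b⟩ : Snapshot P) l)
        obtain ⟨τ₁, hle, hτ₁⟩ := labels_iterate_le (s := ⟨ℓ, a⟩) h.injective
          (fun u v i j h₁ h₂ => h.lt u v i j h₁ (Or.inl h₂)) i
          (fun e => h.not_le (by rw [← show u = a from e]; exact hub.le)) hτ'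
        refine hle.trans (hmax u τ₁ hu ?_)
        rwa [labels_iterate_of_not_le (s := ⟨ℓ, b⟩) h.injective hu.lt.not_ge]
    rw [Function.iterate_succ_apply', bubble_move_of_isNext hB key]

/-- What is preserved while a leader bubble is slid out: in `E` the labels are order preserving
and, apart from the leader bubble, the elements without a label form an ideal. -/
structure LeaderInvariant (E : Set P) (s : Snapshot P) : Prop where
  injective : InjectiveLabels s.labels
  mem : s.bubble ∈ E
  labels_bubble : s.labels s.bubble = none
  lt : ∀ u v i j, u < v → v ∈ E → s.labels u = some i → s.labels v = some j → i < j
  hole : ∀ u v, u < v → v ∈ E → v ≠ s.bubble → s.labels v = none →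
    s.labels u = none ∧ u ≠ s.bubble

/-- The label that moves up is the largest among all labels below the bubble, not only among those
covered: any other is carried by, or lies below, a covered element, which is labelled because the
remaining holes form an ideal. -/
theorem LeaderInvariant.move {E : Set P} [Finite P] (hE : IsLowerSet E) {s : Snapshot P}
    (h : LeaderInvariant E s) : LeaderInvariant E s.move := by
  by_cases hn : ∃ u, s.IsNext u
  swap
  · rwa [move_of_not_isNext (by simpa using hn)]
  obtain ⟨u, hu⟩ := hn
  have hb := bubble_move_of_isNext h.injective hu
  have hl := labels_move_of_isNext h.injective hu
  obtain ⟨hub, τ, hτ, hmax⟩ := hu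
  have huE : u ∈ E := hE hub.le h.mem
  have below : ∀ p i, p < s.bubble → s.labels p = some i → i ≤ τ := by
    intro p i hp hi
    obtain ⟨q, hpq, hq⟩ := exists_le_covBy_of_lt hp
    rcases hpq.eq_or_lt with rfl | hpq
    · exact hmax p i hq hi
    · have hqE : q ∈ E := hE hq.le h.mem
      rcases hqτ : s.labels q with _ | i'
      · simp [(h.hole p q hpq hqE hq.lt.ne hqτ).1] at hi
      · exact (h.lt p q i i' hpq hqE hi hqτ).le.trans (hmax q i' hq hqτ)
  refine ⟨injectiveLabels_move h.injective, hb ▸ huE, by rw [hb, hl, if_pos rfl], ?_, ?_⟩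
  · intro p q i j hpq hq hi hj
    rw [hl] at hi hj
    split_ifs at hi hj with h₁ h₂ h₃ h₄ h₅ h₆
    · exact absurd (h₂.trans h₄.symm) hpq.ne
    · subst h₂
      exact h.lt u q i j (hub.lt.trans hpq) hq hi hj
    · subst h₆
      have hij : i ≤ j := by
        have := below p i hpq hi
        rw [hτ] at hj; simpa [← Option.some_inj.1 hj] using this
      refine lt_of_le_of_ne hij fun e => h₁ (h.injective p u i hi (e ▸ hj))
    · exact h.lt p q i j hpq hq hi hj
  · intro p q hpq hq hqu hj
    rw [hb] at hqu ⊢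
    rw [hl, if_neg hqu] at hj
    split_ifs at hj with h₂
    · simp [hτ] at hj
    obtain ⟨h₃, h₄⟩ := h.hole p q hpq hq h₂ hj
    have h₅ : p ≠ u := by rintro rfl; simp [hτ] at h₃
    exact ⟨by rw [hl, if_neg h₅, if_neg h₄, h₃], h₅⟩

/-- A bubble that has been slid out covers no label, so nothing below it carries one. Its location
is then no longer an exception to the condition on holes. -/
theorem LeaderInvariant.slideOut {E : Set P} [Finite P] (hE : IsLowerSet E) {s : Snapshot P}
    (h : LeaderInvariant E s) : LeaderInvariant E s.slideOut ∧
      ∀ u v, u < v → v ∈ E → s.slideOut.labels v = none → s.slideOut.labels u = none := by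
  have inv : ∀ k, LeaderInvariant E (Snapshot.move^[k] s) := by
    intro k
    induction k with
    | zero => exact h
    | succ k ih => rw [Function.iterate_succ_apply']; exact ih.move hE
  have hout : LeaderInvariant E s.slideOut := inv _
  refine ⟨hout, fun u v huv hv hn => ?_⟩
  by_cases hvb : v = s.slideOut.bubble
  · have none_of_covBy : ∀ q, q ⋖ s.slideOut.bubble → s.slideOut.labels q = none := by
      intro q hq
      rcases hqτ : s.slideOut.labels q with _ | i
      · rfl
      · obtain ⟨q', hq'⟩ := exists_isNext hq hqτ
        have := bubble_move_of_isNext hout.injective hq'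
        rw [move_slideOut] at this
        exact absurd this hq'.1.lt.ne'
    subst hvb
    obtain ⟨q, hpq, hq⟩ := exists_le_covBy_of_lt huv
    rcases hpq.eq_or_lt with rfl | hpq
    · exact none_of_covBy _ hq
    · exact (hout.hole u q hpq (hE hq.le hv) hq.lt.ne (none_of_covBy q hq)).1
  · exact (hout.hole u v huv hv hvb hn).1

end Moves

/-! ### Comparing moves in the poset and in a component -/

section Restriction

variable {P : Type*} [PartialOrder P] {C : Set P} {f : ℕ → ℕ}

/-- The labels of `P` restrict to those of `C`, up to the renaming `f` of labels. -/
def LabelsRestrict (f : ℕ → ℕ) (ℓ : P → Option ℕ) (ℓ' : C → Option ℕ) : Prop :=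
  ∀ c : C, ℓ c = (ℓ' c).map f

theorem LabelsRestrict.injective {α : Type*} {C : Set α} {ℓ : α → Option ℕ} {ℓ' : C → Option ℕ}
    (h : LabelsRestrict f ℓ ℓ') (hℓ : InjectiveLabels ℓ) : InjectiveLabels ℓ' := by
  intro u v j hu hv
  refine Subtype.ext (hℓ u v (f j) ?_ ?_)
  · rw [h u, hu, Option.map_some]
  · rw [h v, hv, Option.map_some]

/-- The snapshot of `P` restricts to that of `C`, up to the renaming `f` of labels. -/
structure Restricts (f : ℕ → ℕ) (s : Snapshot P) (t : Snapshot C) : Prop where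
  labels : LabelsRestrict f s.labels t.labels
  bubble : s.bubble = t.bubble

theorem Restricts.isNext_iff (hC : C.OrdConnected) (hf : StrictMono f)
    {s : Snapshot P} {t : Snapshot C} (h : Restricts f s t) {u : C} (hu : s.IsNext u) :
    t.IsNext u := by
  obtain ⟨hcov, j, hj, hmax⟩ := hu
  rw [h.bubble, coe_covBy_coe hC] at hcov
  rw [h.labels u, Option.map_eq_some_iff] at hj
  obtain ⟨i, hi, rfl⟩ := hj
  refine ⟨hcov, i, hi, fun v k hv hk => hf.le_iff_le.1 (hmax v (f k) ?_ ?_)⟩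
  · rwa [h.bubble, coe_covBy_coe hC]
  · rw [h.labels v, hk, Option.map_some]

/-- Covers in a convex subset are covers in the poset. So a largest covered label that happens to
lie in `C` is also largest within `C`, and a bubble stuck in the poset is stuck in `C`. -/
theorem Restricts.move [Finite P] (hC : C.OrdConnected) (hf : StrictMono f)
    {s : Snapshot P} {t : Snapshot C} (h : Restricts f s t) (hs : InjectiveLabels s.labels)
    (hmem : ∀ u, s.IsNext u → u ∈ C) : Restricts f s.move t.move := by
  have ht : InjectiveLabels t.labels := h.labels.injective hs
  by_cases hn : ∃ u, s.IsNext u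
  · obtain ⟨u, hu⟩ := hn
    lift u to C using hmem u hu
    have hu' : t.IsNext u := h.isNext_iff hC hf hu
    refine ⟨fun c => ?_, by rw [bubble_move_of_isNext hs hu, bubble_move_of_isNext ht hu']⟩
    rw [labels_move_of_isNext hs hu, labels_move_of_isNext ht hu', h.bubble, h.labels, h.labels]
    split_ifs <;> simp_all [Subtype.ext_iff]
  · have hn' : ∀ u, ¬ t.IsNext u := by
      rintro u ⟨hcov, j, hj, -⟩
      refine hn (exists_isNext (u := u) (j := f j) ?_ ?_)
      · rwa [h.bubble, coe_covBy_coe hC]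
      · rw [h.labels u, hj, Option.map_some]
    rwa [move_of_not_isNext (by simpa using hn), move_of_not_isNext hn']

theorem Restricts.iterate [Finite P] (hC : C.OrdConnected) (hf : StrictMono f)
    {s : Snapshot P} {t : Snapshot C} (h : Restricts f s t) (hs : InjectiveLabels s.labels)
    (k : ℕ) (hmem : ∀ l < k, Restricts f (Snapshot.move^[l] s) (Snapshot.move^[l] t) →
      ∀ u, (Snapshot.move^[l] s).IsNext u → u ∈ C) :
    Restricts f (Snapshot.move^[k] s) (Snapshot.move^[k] t) := by
  induction k with
  | zero => exact h
  | succ k ih =>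
    have ih := ih fun l hl => hmem l (by omega)
    rw [Function.iterate_succ_apply', Function.iterate_succ_apply']
    exact ih.move hC hf (injectiveLabels_iterate hs k) (hmem k (by omega) ih)

/-- A bubble which does not occupy an acyclic element moves in `P` as it does in `C`. -/
theorem Restricts.iterate_of_not_acyclic [Finite P] (hd : DComplete P)
    (hC : IsIrreducibleComponent C) (hf : StrictMono f) {s : Snapshot P} {t : Snapshot C}
    (h : Restricts f s t) (hs : InjectiveLabels s.labels) (k : ℕ)
    (hk : ∀ l < k, (Snapshot.move^[l] t).bubble ∉ acyclic C) :
    Restricts f (Snapshot.move^[k] s) (Snapshot.move^[k] t) :=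
  h.iterate (hC.ordConnected hd) hf hs k fun l hl hr _ hu =>
    hC.mem_of_covBy hd (hk l hl) (hr.bubble ▸ hu.1)

theorem Restricts.slideOut [Finite P] (hd : DComplete P)
    (hC : IsIrreducibleComponent C) (hf : StrictMono f) {s : Snapshot P} {t : Snapshot C}
    (h : Restricts f s t) (hs : InjectiveLabels s.labels)
    (hk : ∀ p ∈ path t, p ∉ acyclic C) : Restricts f s.slideOut t.slideOut := by
  have hr := h.iterate_of_not_acyclic hd hC hf hs (Nat.card P) fun l _ => hk _ (mem_path t l)
  have hcard : Nat.card C ≤ Nat.card P := Nat.card_le_card_of_injective _ Subtype.val_injective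
  -- `slideOut` in `C` makes only `Nat.card C` moves; the extra ones are idle.
  have : Snapshot.move^[Nat.card P] t = t.slideOut := by
    obtain ⟨d, hd⟩ := Nat.exists_eq_add_of_le' hcard
    rw [hd, Function.iterate_add_apply]
    exact Function.iterate_fixed (move_slideOut t) d
  rwa [this] at hr

/-! ### Transferring a round of the procedure -/

/-- If the paths of two test bubbles which start at incomparable elements of `C` meet, then they
do not leave `C`. -/
theorem IsIrreducibleComponent.path_subset [Finite P] (hd : DComplete P)
    (hC : IsIrreducibleComponent C) {ℓ : P → Option ℕ} (hℓ : InjectiveLabels ℓ) {a b c : P}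
    (hab : ¬ a ≤ b) (hba : ¬ b ≤ a) (ha : a ∈ C) (hca : c ∈ path ⟨ℓ, a⟩) (hcb : c ≤ b) :
    path ⟨ℓ, a⟩ ⊆ C := by
  rintro _ ⟨k, rfl⟩
  induction k with
  | zero => exact ha
  | succ k ih =>
    have hk : InjectiveLabels (move^[k] (⟨ℓ, a⟩ : Snapshot P)).labels :=
      injectiveLabels_iterate (s := ⟨ℓ, a⟩) hℓ k
    change (move^[k + 1] (⟨ℓ, a⟩ : Snapshot P)).bubble ∈ C
    by_cases hn : ∃ u, (move^[k] (⟨ℓ, a⟩ : Snapshot P)).IsNext u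
    swap
    · rw [Function.iterate_succ_apply', move_of_not_isNext (by simpa using hn)]
      exact ih
    obtain ⟨u, hu⟩ := hn
    have hbu : (move^[k + 1] (⟨ℓ, a⟩ : Snapshot P)).bubble = u := by
      rw [Function.iterate_succ_apply', bubble_move_of_isNext hk hu]
    rw [hbu]
    by_contra huC
    have hs := hC.isSlantEdge hu.1 ih huC
    set p := (move^[k] (⟨ℓ, a⟩ : Snapshot P)).bubble with hp
    have hpa : p ≤ a := iterate_le (⟨ℓ, a⟩ : Snapshot P) k
    -- The meeting point `c` is either weakly above `p`, or below the lower end `u` of the slant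
    -- edge; in the second case everything above `c` but not below `u` is above `p`. Either way `p`
    -- is below both `a` and `b`, which the top tree condition then makes comparable.
    have hpb : p ≤ b := by
      obtain ⟨l, rfl⟩ := hca
      rcases le_or_gt l k with hl | hl
      · exact (iterate_antitone (⟨ℓ, a⟩ : Snapshot P) hl).trans hcb
      · have hcu : (move^[l] (⟨ℓ, a⟩ : Snapshot P)).bubble ≤ u := by
          rw [← hbu]; exact iterate_antitone (⟨ℓ, a⟩ : Snapshot P) hl
        exact (hs.le_or_le hd hcu hcb).resolve_left
          fun h => hba (h.trans (hs.1.le.trans hpa))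
    rcases hs.2.2.1.total (Set.mem_Ici.2 hpa) (Set.mem_Ici.2 hpb) with h | h
    · exact hab h
    · exact hba h

theorem Restricts.iterate_of_path_subset [Finite P] (hC : C.OrdConnected) (hf : StrictMono f)
    {s : Snapshot P} {t : Snapshot C} (h : Restricts f s t) (hs : InjectiveLabels s.labels)
    (hpath : path s ⊆ C) (k : ℕ) : Restricts f (Snapshot.move^[k] s) (Snapshot.move^[k] t) := by
  refine h.iterate hC hf hs k fun l _ _ u hu => ?_
  rw [← bubble_move_of_isNext (injectiveLabels_iterate hs l) hu,
    ← Function.iterate_succ_apply' Snapshot.move]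
  exact hpath (mem_path s _)

theorem coe_mem_path_iff {s : Snapshot P} {t : Snapshot C}
    (h : ∀ k, Restricts f (Snapshot.move^[k] s) (Snapshot.move^[k] t)) (c : C) :
    (c : P) ∈ path s ↔ c ∈ path t := by
  refine exists_congr fun k => ?_
  change (Snapshot.move^[k] s).bubble = c ↔ _
  rw [(h k).bubble, Subtype.coe_inj]

/-- A collision in `C` is a collision in `P`, if the paths do not leave `C`. -/
theorem IsCollision.of_restricts {ℓ : P → Option ℕ} {ℓ' : C → Option ℕ}
    {a b w x y : C} {i j σ : ℕ} (hℓ : LabelsRestrict f ℓ ℓ')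
    (ha : ∀ k, Restricts f (move^[k] ⟨ℓ, a⟩) (move^[k] ⟨ℓ', a⟩))
    (hb : ∀ k, Restricts f (move^[k] ⟨ℓ, b⟩) (move^[k] ⟨ℓ', b⟩))
    (hpath : path ⟨ℓ, (a : P)⟩ ⊆ C) (h : IsCollision ℓ' a b w x y i j σ) :
    IsCollision ℓ (a : P) b w x y i j (f σ) where
  isGreatest := by
    refine ⟨⟨(coe_mem_path_iff ha w).2 h.isGreatest.1.1, (coe_mem_path_iff hb w).2
      h.isGreatest.1.2⟩, fun c hc => ?_⟩
    lift c to C using hpath hc.1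
    exact h.isGreatest.2 ⟨(coe_mem_path_iff ha c).1 hc.1, (coe_mem_path_iff hb c).1 hc.2⟩
  label := by rw [hℓ w, h.label, Option.map_some]
  x_ne := fun e => h.x_ne (Subtype.ext e)
  x_eq := by rw [(ha i).bubble, h.x_eq]
  x_next := by rw [(ha (i + 1)).bubble, h.x_next]
  y_ne := fun e => h.y_ne (Subtype.ext e)
  y_eq := by rw [(hb j).bubble, h.y_eq]
  y_next := by rw [(hb (j + 1)).bubble, h.y_next]

theorem injectiveLabels_approach {ℓ : P → Option ℕ} (h : InjectiveLabels ℓ) (a b : P)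
    (i j : ℕ) : InjectiveLabels (approach ℓ a b i j) :=
  injectiveLabels_iterate (s := ⟨_, b⟩) (injectiveLabels_iterate (s := ⟨ℓ, a⟩) h i) j

/-- `approach` moves `B` through labels already changed by `A`, whereas `hpath` confines `B` only
for the original labels. `RoundInvariant.bubble_iterate` identifies the two paths as far as they are
needed. -/
theorem RoundInvariant.labelsRestrict_approach [Finite P] (hC : C.OrdConnected)
    (hf : StrictMono f) {ℓ : P → Option ℕ} {ℓ' : C → Option ℕ}
    {a b w x y : C} {i j σ : ℕ} (h : RoundInvariant ℓ (a : P) b)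
    (ha : ∀ k, Restricts f (move^[k] ⟨ℓ, a⟩) (move^[k] ⟨ℓ', a⟩))
    (hpath : path ⟨ℓ, (b : P)⟩ ⊆ C) (hc : IsCollision ℓ (a : P) b w x y i j σ) :
    LabelsRestrict f (approach ℓ (a : P) b i j) (approach ℓ' a b i j) := by
  have hA : InjectiveLabels (move^[i] (⟨ℓ, a⟩ : Snapshot P)).labels :=
    injectiveLabels_iterate (s := ⟨ℓ, a⟩) h.injective i
  have h₀ : Restricts f (⟨(move^[i] (⟨ℓ, a⟩ : Snapshot P)).labels, b⟩ : Snapshot P)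
    (⟨(move^[i] (⟨ℓ', a⟩ : Snapshot C)).labels, b⟩ : Snapshot C) := ⟨(ha i).labels, rfl⟩
  refine (h₀.iterate hC hf hA j fun l hl _ u hu => ?_).labels
  rw [← bubble_move_of_isNext 
    (injectiveLabels_iterate (s := ⟨(move^[i] ⟨ℓ, a⟩).labels, b⟩) hA l) hu,
    ← Function.iterate_succ_apply' Snapshot.move, h.bubble_iterate hc hl]
  exact hpath (mem_path _ _)

theorem LabelsRestrict.leaderStart {α : Type*} {C : Set α} {ℓ : α → Option ℕ} {ℓ' : C → Option ℕ}
    (h : LabelsRestrict f ℓ ℓ') (w z : C) (σ : ℕ) :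
    Restricts f (leaderStart ℓ (w : α) z (f σ)) (leaderStart ℓ' w z σ) := by
  refine ⟨fun p => ?_, rfl⟩
  have hp := h p
  simp only [DCompletePoset.leaderStart, Function.update_apply]
  split_ifs <;> simp_all [Subtype.ext_iff]

theorem injectiveLabels_leaderStart {α : Type*} {ℓ : α → Option ℕ} (h : InjectiveLabels ℓ)
    {w z : α} {σ : ℕ}
    (hw : ℓ w = some σ) : InjectiveLabels (leaderStart ℓ w z σ).labels := by
  intro p q j hp hq
  simp only [leaderStart, Function.update_apply] at hp hq
  have := h p q j
  have := h p w j
  have := h w q j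
  split_ifs at hp hq <;> simp_all

open Classical in
/-- A repair keeps the round invariant. -/
theorem RoundInvariant.next [Finite P] {ℓ : P → Option ℕ} {a b v w x y z : P} {i j k σ : ℕ}
    (h : RoundInvariant ℓ a b) (hc : IsCollision ℓ a b w x y i j σ) (hxz : x ⋖ z) (hyz : y ⋖ z)
    (hk : (move^[k] ⟨approach ℓ a b i j, v⟩).bubble = z) :
    InjectiveLabels (leaderStart (move^[k] ⟨approach ℓ a b i j, v⟩).labels w z σ).labels ∧
    RoundInvariant
      (leaderStart (move^[k] ⟨approach ℓ a b i j, v⟩).labels w z σ).slideOut.labels x y := by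
  have hA : InjectiveLabels (move^[i] (⟨ℓ, a⟩ : Snapshot P)).labels :=
    injectiveLabels_iterate (s := ⟨ℓ, a⟩) h.injective i
  have hAB := injectiveLabels_approach h.injective a b i j
  have hG := injectiveLabels_iterate (s := ⟨approach ℓ a b i j, v⟩) hAB k
  have hwx : w ⋖ x := by
    have := (isNext_of_ne (s := ⟨ℓ, a⟩) h.injective (Nat.lt_succ_self i)
      (by rw [hc.x_eq, hc.x_next]; exact hc.x_ne.symm)).1
    rwa [hc.x_eq, hc.x_next] at this
  have hwy : w ⋖ y := by
    have := (isNext_of_ne (s := ⟨ℓ, b⟩) h.injective (Nat.lt_succ_self j)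
      (by rw [hc.y_eq, hc.y_next]; exact hc.y_ne.symm)).1
    rwa [hc.y_eq, hc.y_next] at this
  have hxy : x ≠ y := by
    rintro rfl
    refine hwx.lt.not_ge (hc.isGreatest.2 ⟨?_, ?_⟩)
    · rw [← hc.x_eq]; exact mem_path _ _
    · rw [← hc.y_eq]; exact mem_path _ _
  have hnle : ¬ x ≤ y := fun hle => hwy.2 hwx.lt (lt_of_le_of_ne hle hxy)
  have hnge : ¬ y ≤ x := fun hle => hwx.2 hwy.lt (lt_of_le_of_ne hle hxy.symm)
  have hxa : x ≤ a := by rw [← hc.x_eq]; exact iterate_le (⟨ℓ, a⟩ : Snapshot P) i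
  have hyb : y ≤ b := by rw [← hc.y_eq]; exact iterate_le (⟨ℓ, b⟩ : Snapshot P) j
  have hE : ∀ p, p < x ∨ p < y → p < a ∨ p < b := fun p hp =>
    hp.imp (·.trans_le hxa) (·.trans_le hyb)
  -- The test bubbles stop at `x` and `y`, and the repair bubble stops above both, so nothing
  -- strictly below `x` or `y` has been touched when the leader bubble starts.
  have hunch : ∀ p, p < x ∨ p < y →
      (move^[k] ⟨approach ℓ a b i j, v⟩).labels p = ℓ p ∧ p ≠ z := by
    intro p hp
    have hpx : ¬ x ≤ p := fun hle => hp.elim (fun h => h.not_ge hle)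
      fun h => hnle (hle.trans h.le)
    have hpy : ¬ y ≤ p := fun hle => hp.elim (fun h => hnge (hle.trans h.le))
      fun h => h.not_ge hle
    have hpz : ¬ z ≤ p := fun hle => hpx (hxz.le.trans hle)
    refine ⟨?_, fun e => hpz e.ge⟩
    rw [labels_iterate_of_not_le (s := ⟨approach ℓ a b i j, v⟩) hAB (by rwa [hk])]
    change (move^[j] (⟨(move^[i] ⟨ℓ, a⟩).labels, b⟩ : Snapshot P)).labels p = ℓ p
    rw [labels_iterate_of_not_le (s := ⟨(move^[i] ⟨ℓ, a⟩).labels, b⟩) hA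
      (by rwa [h.bubble_iterate hc le_rfl, hc.y_eq])]
    exact labels_iterate_of_not_le (s := ⟨ℓ, a⟩) h.injective (by rwa [hc.x_eq])
  have hinj : InjectiveLabels
      (leaderStart (move^[k] ⟨approach ℓ a b i j, v⟩).labels w z σ).labels :=
    injectiveLabels_leaderStart hG (by rw [(hunch w (Or.inl hwx.lt)).1, hc.label])
  refine ⟨hinj, ?_⟩
  have hlab : ∀ p, p < x ∨ p < y →
      (leaderStart (move^[k] ⟨approach ℓ a b i j, v⟩).labels w z σ).labels p =
        if p = w then none else ℓ p := by
    intro p hp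
    simp only [leaderStart, Function.update_apply, (hunch p hp).1, (hunch p hp).2, if_false]
  have hlower : IsLowerSet {p | p < x ∨ p < y} := fun p q hqp hp =>
    hp.imp (hqp.trans_lt ·) (hqp.trans_lt ·)
  have hstart : LeaderInvariant {p | p < x ∨ p < y}
      (leaderStart (move^[k] ⟨approach ℓ a b i j, v⟩).labels w z σ) := by
    refine ⟨hinj, Or.inl hwx.lt, by simp [leaderStart], ?_, ?_⟩
    · intro p q i' j' hpq hq hi hj
      rw [hlab p (hlower hpq.le hq)] at hi
      rw [hlab q hq] at hj
      split_ifs at hi hj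
      exact h.lt p q i' j' hpq (hE q hq) hi hj
    · intro p q hpq hq hqw hn
      change q ≠ w at hqw
      rw [hlab q hq, if_neg hqw] at hn
      have hp := h.hole p q hpq (hE q hq) hn
      refine ⟨by rw [hlab p (hlower hpq.le hq), hp, ite_self], ?_⟩
      rintro (rfl : p = w)
      simp [hc.label] at hp
  obtain ⟨hout, hhole⟩ := hstart.slideOut hlower
  exact ⟨hout.injective, hnle, hnge, hout.lt, hhole⟩

/-- A strong solution in a component solves the challenge in `P`, possibly in fewer rounds. -/
theorem SolvesFrom.of_component [Finite P] (hd : DComplete P) (hC : IsIrreducibleComponent C)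
    (hf : StrictMono f) {n : ℕ} (v : Fin n → C) (m r : ℕ) {ℓ : P → Option ℕ}
    {ℓ' : C → Option ℕ} {a b : C} (hℓ : LabelsRestrict f ℓ ℓ') (h : RoundInvariant ℓ (a : P) b)
    (hsol : SolvesFrom (acyclic C) v m r ℓ' a b) :
    ∃ m', SolvesFrom (∅ : Set P) (fun i => (v i : P)) m' r ℓ a b := by
  induction m generalizing r ℓ ℓ' a b with
  | zero =>
    refine ⟨0, Set.eq_empty_of_forall_notMem fun c hc => ?_⟩
    have hcon := hC.ordConnected hd
    have hpa := hC.path_subset hd h.injective h.not_le h.not_ge a.2 hc.1 (le_of_mem_path hc.2)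
    have hpb := hC.path_subset hd h.injective h.not_ge h.not_le b.2 hc.2 (le_of_mem_path hc.1)
    have ha := Restricts.iterate_of_path_subset hcon hf
      (s := ⟨ℓ, a⟩) (t := ⟨ℓ', a⟩) ⟨hℓ, rfl⟩ h.injective hpa
    have hb := Restricts.iterate_of_path_subset hcon hf
      (s := ⟨ℓ, b⟩) (t := ⟨ℓ', b⟩) ⟨hℓ, rfl⟩ h.injective hpb
    lift c to C using hpa hc.1
    exact Set.eq_empty_iff_forall_notMem.1 hsol c
      ⟨(coe_mem_path_iff ha c).1 hc.1, (coe_mem_path_iff hb c).1 hc.2⟩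
  | succ m ih =>
    -- A test bubble may leave `C` in the poset while its copy in `C` goes on to a collision; no
    -- further repair is needed then.
    by_cases hdisj : path ⟨ℓ, (a : P)⟩ ∩ path ⟨ℓ, (b : P)⟩ = ∅
    · exact ⟨0, hdisj⟩
    obtain ⟨c, hc⟩ := Set.nonempty_iff_ne_empty.2 hdisj
    have hcon := hC.ordConnected hd
    have hpa := hC.path_subset hd h.injective h.not_le h.not_ge a.2 hc.1 (le_of_mem_path hc.2)
    have hpb := hC.path_subset hd h.injective h.not_ge h.not_le b.2 hc.2 (le_of_mem_path hc.1)
    have ha := Restricts.iterate_of_path_subset hcon hf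
      (s := ⟨ℓ, a⟩) (t := ⟨ℓ', a⟩) ⟨hℓ, rfl⟩ h.injective hpa
    have hb := Restricts.iterate_of_path_subset hcon hf
      (s := ⟨ℓ, b⟩) (t := ⟨ℓ', b⟩) ⟨hℓ, rfl⟩ h.injective hpb
    obtain ⟨hr, ℓ₁', x, y, ⟨w, z, i, j, k, σ, hcol', hxz, hyz, hk, hmax, hG, hL, rfl⟩, hrest⟩ :=
      hsol
    have hcol := hcol'.of_restricts hℓ ha hb hpa
    have happ := h.labelsRestrict_approach hcon hf ha hpb hcol
    have hinj := injectiveLabels_approach h.injective (a : P) b i j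
    have hslide := Restricts.iterate_of_not_acyclic hd hC hf
      (s := ⟨approach ℓ (a : P) b i j, v ⟨r, hr⟩⟩) (t := ⟨approach ℓ' a b i j, v ⟨r, hr⟩⟩)
      ⟨happ, rfl⟩ hinj k fun l hl => hG l hl.le
    have hkP : (move^[k] (⟨approach ℓ (a : P) b i j, v ⟨r, hr⟩⟩ : Snapshot P)).bubble = z := by
      rw [hslide.bubble, hk]
    have hxzP := (coe_covBy_coe hcon).2 hxz
    have hyzP := (coe_covBy_coe hcon).2 hyz
    obtain ⟨hstart, hnext⟩ := h.next hcol hxzP hyzP hkP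
    have hlead : Restricts f
        (leaderStart (move^[k] (⟨approach ℓ (a : P) b i j, v ⟨r, hr⟩⟩ : Snapshot P)).labels
          (w : P) z (f σ))
        (leaderStart (move^[k] (⟨approach ℓ' a b i j, v ⟨r, hr⟩⟩ : Snapshot C)).labels w z σ) :=
      hslide.labels.leaderStart w z σ
    have hout := hlead.slideOut hd hC hf hstart hL
    obtain ⟨m', hm'⟩ := ih (r + 1) hout.labels hnext hrest
    refine ⟨m' + 1, hr, _, x, y, ⟨w, z, i, j, k, f σ, hcol, hxzP, hyzP, hkP, ?_, ?_, ?_, rfl⟩, hm'⟩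
    · intro u τ hu hux huy hτ
      -- Strongness includes the arrival at `z`, so `z` is not acyclic in `C` and covers only
      -- elements of `C`; hence `σ` has no new competitors.
      have hz := hG k le_rfl
      rw [hk] at hz
      lift u to C using hC.mem_of_covBy hd hz hu
      rw [hℓ u, Option.map_eq_some_iff] at hτ
      obtain ⟨τ', hτ', rfl⟩ := hτ
      exact hf (hmax u τ' ((coe_covBy_coe hcon).1 hu) (fun e => hux (e ▸ rfl))
        (fun e => huy (e ▸ rfl)) hτ')
    · exact fun _ _ => Set.notMem_empty _
    · exact fun _ _ => Set.notMem_empty _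

/-! ### Restricting the challenge and extending the test numbering -/

theorem Numbering.lt_of_labels {D : Set P} (ρ : Numbering D) {u v : P} {i j : ℕ} (huv : u < v)
    (hi : ρ.labels u = some i) (hj : ρ.labels v = some j) : i < j := by
  simp only [Numbering.labels, Option.dite_none_right_eq_some, Option.some.injEq] at hi hj
  obtain ⟨hu, rfl⟩ := hi
  obtain ⟨hv, rfl⟩ := hj
  refine lt_of_le_of_ne (ρ.monotone (Subtype.mk_le_mk.2 huv.le)) fun e => huv.ne ?_
  exact congrArg Subtype.val (ρ.toEquiv.injective (Fin.ext e))

theorem Numbering.injectiveLabels {D : Set P} (ρ : Numbering D) : InjectiveLabels ρ.labels := by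
  intro u v j hi hj
  simp only [Numbering.labels, Option.dite_none_right_eq_some, Option.some.injEq] at hi hj
  obtain ⟨hu, hi⟩ := hi
  obtain ⟨hv, rfl⟩ := hj
  exact congrArg Subtype.val (ρ.toEquiv.injective (Fin.ext hi))

/-- By incomparability everything strictly below `x` or `y` lies in `pairIdeal x y` and is labelled,
so the condition on holes is vacuous at the start. -/
theorem Numbering.roundInvariant {x y : P} (hxy : ¬ x ≤ y) (hyx : ¬ y ≤ x)
    (ρ : Numbering (pairIdeal x y)) : RoundInvariant ρ.labels x y := by
  refine ⟨ρ.injectiveLabels, hxy, hyx, fun u v i j huv _ => ρ.lt_of_labels huv, ?_⟩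
  intro u v _ hv hn
  have hmem : v ∈ pairIdeal x y := by
    rintro (h | h) <;> rcases hv with hv | hv
    · exact hv.not_ge h
    · exact hxy (h.trans hv.le)
    · exact hyx (h.trans hv.le)
    · exact hv.not_ge h
  simp [Numbering.labels, hmem] at hn

/-- The numbering of `I_{xy}` induced on a subset of the poset. -/
theorem Numbering.exists_restrict [Finite P] {x y : C} (ρ : Numbering (pairIdeal (x : P) y)) :
    ∃ (f : ℕ → ℕ) (ρ' : Numbering (pairIdeal x y)), StrictMono f ∧
      LabelsRestrict f ρ.labels ρ'.labels := by
  classical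
  let g : pairIdeal x y → Fin (Nat.card (pairIdeal (x : P) y)) := fun c => ρ.toEquiv ⟨c.1.1, c.2⟩
  have hg : Function.Injective g := fun c d hcd =>
    by
    have := ρ.toEquiv.injective hcd
    simpa [Subtype.ext_iff] using this
  have : Fintype (pairIdeal x y) := Fintype.ofFinite _
  let S : Finset (Fin (Nat.card (pairIdeal (x : P) y))) := Finset.univ.image g
  have hS : S.card = Nat.card (pairIdeal x y) := by
    rw [Finset.card_image_of_injective _ hg, Nat.card_eq_fintype_card, Finset.card_univ]
  let e : pairIdeal x y ≃ S := Equiv.ofBijective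
    (fun c => ⟨g c, Finset.mem_image_of_mem g (Finset.mem_univ c)⟩)
    ⟨fun c d h => hg (congrArg Subtype.val h), by
      rintro ⟨s, hs⟩
      obtain ⟨c, -, rfl⟩ := Finset.mem_image.1 hs
      exact ⟨c, rfl⟩⟩
  let o := S.orderIsoOfFin hS
  -- `f` sends a rank to the corresponding label among those used in `C`. Past the last rank it
  -- exceeds all labels, only to be strictly monotone on all of `ℕ`.
  let f : ℕ → ℕ := fun k =>
    if h : k < Nat.card (pairIdeal x y) then ((o ⟨k, h⟩ : S).1 : ℕ)
    else Nat.card (pairIdeal (x : P) y) + k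
  refine ⟨f, ⟨e.trans o.symm.toEquiv, fun c d hcd => ?_⟩, ?_, fun c => ?_⟩
  · exact o.symm.monotone (show e c ≤ e d from ρ.monotone hcd)
  · intro k l hkl
    simp only [f]
    split_ifs with h₁ h₂ h₂
    · exact o.strictMono (show (⟨k, h₁⟩ : Fin _) < ⟨l, h₂⟩ from hkl)
    · exact Nat.lt_add_right _ (Fin.is_lt _)
    · omega
    · omega
  · by_cases hc : c ∈ pairIdeal x y
    · have hc' : (c : P) ∈ pairIdeal (x : P) y := hc
      have hk : (o (o.symm (e ⟨c, hc⟩)) : S) = e ⟨c, hc⟩ := o.apply_symm_apply _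
      have hfk : f (o.symm (e ⟨c, hc⟩)) = (g ⟨c, hc⟩ : ℕ) := by
        simp only [f, Fin.is_lt, dif_pos, Fin.eta, hk]
        rfl
      simp only [Numbering.labels, dif_pos hc, dif_pos hc', Option.map_some]
      exact congrArg some hfk.symm
    · have hc' : (c : P) ∉ pairIdeal (x : P) y := hc
      simp [Numbering.labels, hc, hc']

/-- A test numbering in an order connected subset, considered in the poset. -/
theorem PairTestNumbering.exists_extend (hC : C.OrdConnected) {x y : C} {J : Set C} {n : ℕ}
    (γ : PairTestNumbering x y J n) :
    ∃ γ' : PairTestNumbering (x : P) y (Subtype.val '' J) n, γ'.site = fun i => (γ.site i : P) := by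
  obtain ⟨hx, hxA⟩ := γ.map_x
  obtain ⟨hy, hyB⟩ := γ.map_y
  let e : J ≃ Subtype.val '' J := Equiv.Set.image _ J Subtype.val_injective
  have he : ∀ p : J, ((e p : P)) = p := fun p => rfl
  refine ⟨⟨⟨e.symm.trans γ.toEquiv, fun p q hpq => ?_⟩, ?_, ?_, ?_, ?_⟩, ?_⟩
  · refine γ.monotone _ _ ?_
    have hp := he (e.symm p)
    have hq := he (e.symm q)
    rw [Equiv.apply_symm_apply] at hp hq
    change ((e.symm p : C) : P) ≤ (e.symm q : C)
    rw [← hp, ← hq]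
    exact hpq
  · rintro _ ⟨p, hp, rfl⟩
    exact γ.subset hp
  · rintro _ ⟨p, hp, rfl⟩ q hq hqp
    -- Convexity is what makes the image of `J` an ideal of the larger filter.
    have hqC : q ∈ C := hq.elim (fun h => hC.out x.2 p.2 ⟨h, hqp⟩)
      (fun h => hC.out y.2 p.2 ⟨h, hqp⟩)
    exact ⟨⟨q, hqC⟩, γ.ideal p hp ⟨q, hqC⟩ hq hqp, rfl⟩
  · refine ⟨⟨x, hx, rfl⟩, ?_⟩
    rw [← hxA]
    exact congrArg γ.toEquiv (e.symm_apply_apply ⟨x, hx⟩)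
  · refine ⟨⟨y, hy, rfl⟩, ?_⟩
    rw [← hyB]
    exact congrArg γ.toEquiv (e.symm_apply_apply ⟨y, hy⟩)
  · rfl

theorem IsCrucialPair.of_coe (hC : C.OrdConnected) {x y : C} (h : IsCrucialPair (x : P) y)
    (hw : ∃ w : C, w < x ∧ w < y) : IsCrucialPair x y :=
  ⟨h.1, h.2.1, fun z => by rw [← coe_covBy_coe hC, ← coe_covBy_coe hC]; exact h.2.2.1 z, hw⟩

end Restriction

end DCompletePoset

open DCompletePoset in
theorem proposition8p3 (Q : Type*) [PartialOrder Q] [Finite Q]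
    (hconn : (SimpleGraph.hasse Q).Connected) (hd : DCompletePoset.DComplete Q)
    (hstrong : ∀ C : Set Q, DCompletePoset.IsIrreducibleComponent C →
      DCompletePoset.StronglySimultaneous C) :
    DCompletePoset.Simultaneous Q := by
  intro x y hxy ρ
  obtain ⟨C, hC, hx, hy, w, hw, hwx, hwy⟩ := hxy.exists_component hd
  have hcon := hC.ordConnected hd
  lift x to C using hx
  lift y to C using hy
  obtain ⟨f, ρ', hf, hρ⟩ := ρ.exists_restrict
  obtain ⟨m, n, J, γ, hγ⟩ := hstrong C hC x y (hxy.of_coe hcon ⟨⟨w, hw⟩, hwx, hwy⟩) ρ'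
  obtain ⟨γ', hγ'⟩ := γ.exists_extend hcon
  obtain ⟨m', hm'⟩ := SolvesFrom.of_component hd hC hf γ.site m 0 hρ
    (ρ.roundInvariant hxy.1 hxy.2.1) hγ
  refine ⟨m', n, _, γ', ?_⟩
  rw [IsSimultaneousSolution, hγ']
  exact hm'
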